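/- **Model.** A configuration of $n\ge 1$ robots is a tuple $r_1,\dots,r_n\in\mathbb R^2$; robot $i$ is the closed disk of diameter $1$ with center $r_i$. Two robots collide if their bounding circles share a point (i.e. their centers are at distance at most $1$). Robot $i$ sees robot $j$ if some segment from the bounding circle of $i$ to the bounding circle of $j$ meets no third robot. A configuration is *mutually visible* if no two robots collide, every robot is a corner of the convex hull of the centers (strictly convex position), and every robot sees every other robot. Robots are anonymous, run the same algorithm, have private coordinate systems (arbitrary Euclidean isometries) and private memory, and act in fully synchronous Look–Compute–Move rounds: in each round every robot takes a snapshot of the positions of the robots it sees, computes a destination and a new memory content from its snapshot and memory, and moves along a straight segment to its destination. **Leader election phase.** Let $c$ be the centroid of the robots (the mean of the corners of their convex hull) and $d$ the distance from $c$ to a farthest robot, computed in the first round and stored. The robots on the circle with center $c$ and radius $d$ are competing; let $k$ be their number. Each iteration takes two rounds. In the first, every competing robot independently flips a coin with success probability $1/k$; if successful it stays, otherwise it stores its location and steps to a point strictly inside the circle, at distance at most $\rho(P)$ from its location, where $P$ is its snapshot and $\rho(P)>0$ is a threshold; other robots stay. In the second, all robots count the robots on the circle. If there is exactly one, it becomes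 the leader, and all robots store that the phase has ended and whether they are the leader. Otherwise, the robots that stepped inside return to their stored locations, and a new iteration starts in the next round. **Theorem.** There are a choice of the threshold function $\rho>0$, a constant $C>0$ and an integer $K$ such that, for every stepping rule (point to which an unsuccessful robot steps, as a function of its snapshot and its own position) that obeys the above constraints, every $n\ge1$, all private coordinate systems, and every mutually visible initial configuration of $n$ robots, the following holds. 1. For all outcomes of the coin flips, at all times, also during the moves and whatever the relative speeds of the robots, the configuration is mutually visible; in particular there are no collisions and the configuration stays convex. 2. For all outcomes of the coin flips, as soon as one robot has stored that the phase has ended, all have, exactly one robot has stored that it is the leader, this robot is on the circle and all others are strictly inside the circle, and nothing changes any more. 3. For all outcomes of the coin flips, the phase uses $O(1)$ memory: at all times each robot stores at most $K$ data, each of which is an integer that is at most $Kn$, the initial location of a robot, or the center or the radius of the circle. 4. For every $q>0$, with probability at least $1-n^{-q}$ the phase has ended with an elected leader after at most $C\,q\log n+2$ rounds, i.e. in $O(q\log n)$ rounds (besides the two rounds of the one iteration that is always needed). -/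

import Mathlib

/-!  Randomized leader election for fat robots in the plane: the model (obstructed visibility,
private coordinate systems, fully synchronous Look-Compute-Move rounds, small private memory)
and the algorithm. -/

open MeasureTheory ProbabilityTheory

namespace FatRobots

/-- The Euclidean plane. -/
abbrev Plane : Type := EuclideanSpace ℝ (Fin 2)

/-- A robot is identified with the position `x` of its center; its body is the closed disk of
diameter 1. -/
def body (x : Plane) : Set Plane := Metric.closedBall x (1 / 2)

/-- The bounding circle of the robot at `x`. -/
def boundingCircle (x : Plane) : Set Plane := Metric.sphere x (1 / 2)

/-- Two robots collide if their bounding circles share a point. -/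
def Collide (x y : Plane) : Prop := (boundingCircle x ∩ boundingCircle y).Nonempty

/-- Collision, in terms of the distance of the centers. -/
theorem collide_iff (x y : Plane) : Collide x y ↔ dist x y ≤ 1 := by
  constructor
  · rintro ⟨z, hx, hy⟩
    have h1 : dist z x = 1 / 2 := hx
    have h2 : dist z y = 1 / 2 := hy
    have h3 := dist_triangle_left x y z
    linarith
  · intro h
    obtain ⟨v, hv, hxy⟩ : ∃ v : Plane, ‖v‖ = 1 ∧ y = x + dist x y • v := by
      rcases eq_or_ne x y with rfl | hne
      · obtain ⟨v, hv⟩ := exists_norm_eq Plane (zero_le_one (α := ℝ))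
        exact ⟨v, hv, by simp⟩
      · have hd : dist x y ≠ 0 := dist_ne_zero.2 hne
        refine ⟨(dist x y)⁻¹ • (y - x), ?_, ?_⟩
        · rw [norm_smul, norm_inv, Real.norm_of_nonneg dist_nonneg, ← dist_eq_norm, dist_comm y x,
            inv_mul_cancel₀ hd]
        · rw [smul_smul, mul_inv_cancel₀ hd, one_smul, add_sub_cancel]
    have hd0 : 0 ≤ dist x y := dist_nonneg
    generalize dist x y = d at h hxy hd0
    have hcon : IsPreconnected (Metric.sphere x (1 / 2 : ℝ)) :=
      isPreconnected_sphere (by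
        rw [← Module.finrank_eq_rank, finrank_euclideanSpace_fin]; norm_num) x _
    have key : ∀ s : ℝ, dist (x + s • v) y = |s - d| := by
      intro s
      rw [hxy, dist_add_left, dist_eq_norm, ← sub_smul, norm_smul, hv, mul_one, Real.norm_eq_abs]
    have hmem : ∀ s : ℝ, |s| = 1 / 2 → x + s • v ∈ Metric.sphere x (1 / 2 : ℝ) := by
      intro s hs
      rw [mem_sphere_iff_norm, add_sub_cancel_left, norm_smul, hv, mul_one, Real.norm_eq_abs, hs]
    obtain ⟨z, hz, hzy⟩ := hcon.intermediate_value (hmem (1 / 2) (by norm_num))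
      (hmem (-(1 / 2)) (by rw [abs_neg]; norm_num)) (f := fun z => dist z y) (by fun_prop)
      (show (1 / 2 : ℝ) ∈ _ from by
        simp only [key]
        exact ⟨abs_le.2 ⟨by linarith, by linarith⟩, by rw [abs_of_nonpos] <;> linarith⟩)
    exact ⟨z, hz, hzy⟩

/-- Robot `i` sees robot `j`: some segment from the bounding circle of `i` to the bounding circle
of `j` meets no third robot. -/
def Sees {n : ℕ} (pos : Fin n → Plane) (i j : Fin n) : Prop :=
  ∃ a ∈ boundingCircle (pos i), ∃ b ∈ boundingCircle (pos j),
    ∀ k, k ≠ i → k ≠ j → Disjoint (segment ℝ a b) (body (pos k))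

/-- A configuration of mutual visibility: no two robots collide, every robot is a corner of the
convex hull of all robots, and every robot sees every other robot. -/
structure MutuallyVisible {n : ℕ} (pos : Fin n → Plane) : Prop where
  collisionFree : ∀ i j, i ≠ j → ¬ Collide (pos i) (pos j)
  convexPosition : ConvexIndependent ℝ pos
  visible : ∀ i j, i ≠ j → Sees pos i j

section Model

/-- A randomized robot algorithm with memory of type `M`. From its memory, the set of the visible
robots (itself included), its own position, and a random number, a robot computes its new memory
and its destination. All locations are expressed in the robot's own coordinate system. -/
structure Algorithm (M : Type) where
  init : M
  compute : M → Finset Plane → Plane → ℝ → M × Plane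

/-- The global state of `n` robots: positions (in the plane) and private memories. -/
structure State (M : Type) (n : ℕ) where
  pos : Fin n → Plane
  mem : Fin n → M

open Classical in
/-- The snapshot taken by robot `i`: the positions of itself and of the robots it sees, in its own
coordinate system `frame`. -/
noncomputable def snapshot {n : ℕ} (frame : Plane ≃ᵃⁱ[ℝ] Plane) (pos : Fin n → Plane)
    (i : Fin n) : Finset Plane :=
  (Finset.univ.filter fun j => j = i ∨ Sees pos i j).image fun j => frame (pos j)

/-- One fully synchronous round: all robots look, compute and move. Robot `i` uses the coordinate
system `frame i` and the random number `u i`. -/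
noncomputable def Algorithm.round {M : Type} (A : Algorithm M) {n : ℕ}
    (frame : Fin n → Plane ≃ᵃⁱ[ℝ] Plane) (u : Fin n → ℝ) (s : State M n) : State M n where
  pos i := (frame i).symm
    (A.compute (s.mem i) (snapshot (frame i) s.pos i) (frame i (s.pos i)) (u i)).2
  mem i := (A.compute (s.mem i) (snapshot (frame i) s.pos i) (frame i (s.pos i)) (u i)).1

/-- The state after `t` rounds from the positions `pos₀`, where `u t i` is the random number that
robot `i` draws in round `t`. -/
noncomputable def Algorithm.run {M : Type} (A : Algorithm M) {n : ℕ}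
    (frame : Fin n → Plane ≃ᵃⁱ[ℝ] Plane) (pos₀ : Fin n → Plane) (u : ℕ → Fin n → ℝ) :
    ℕ → State M n
  | 0 => ⟨pos₀, fun _ => A.init⟩
  | t + 1 => A.round frame (u t) (A.run frame pos₀ u t)

end Model

section LeaderElection

/-- The centroid of (the corners of) the convex hull of robots at the positions `P`. -/
noncomputable def center (P : Finset Plane) : Plane := P.centroid ℝ id

/-- The distance from the centroid to a farthest robot. -/
noncomputable def radius (P : Finset Plane) : ℝ :=
  ((P.sup fun p => nndist p (center P) : NNReal) : ℝ)

/-- Control states: the phase has not begun; a coin was flipped and the outcome is to be observed;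
all competitors are back on the circle for another iteration; the phase has ended. -/
inductive Stage
  | start
  | observe
  | retry
  | ended

/-- The number that encodes a control state in memory. -/
def Stage.code : Stage → ℕ
  | start => 0
  | observe => 1
  | retry => 2
  | ended => 3

/-- The private memory of a robot: control state, number of robots, circle (center and radius),
position on the circle to return to, and whether it is the leader. -/
structure Memory where
  stage : Stage
  count : ℕ
  circle : Option (Plane × ℝ)
  home : Option Plane
  leader : Bool

open Classical in
/-- The number of robots of `P` on the circle with center `c` and radius `d`. -/
noncomputable def numOnCircle (c : Plane) (d : ℝ) (P : Finset Plane) : ℕ :=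
  (P.filter fun p => dist p c = d).card

open Classical in
/-- One iteration of the election, for a robot at `x` that sees robots at `P` and uses the circle
`(c, d)`. A competing robot flips a coin with success probability `1 / k`, where `k` is the number
of competing robots: the coin succeeds if the random number `u`, uniform in `[0, 1]`, is at most
`1 / k`. After a success it stays; otherwise it stores `x` and steps to `step P x`. Other robots
stay. -/
noncomputable def flip (step : Finset Plane → Plane → Plane) (m : Memory) (c : Plane) (d : ℝ)
    (P : Finset Plane) (x : Plane) (u : ℝ) : Memory × Plane :=
  if dist x c = d ∧ ¬ u ≤ 1 / (numOnCircle c d P : ℝ) then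
    ({ m with stage := .observe, circle := some (c, d), home := some x }, step P x)
  else
    ({ m with stage := .observe, circle := some (c, d), home := none }, x)

open Classical in
/-- The observation after an iteration: if exactly one robot is on the circle, it is the leader and
the phase ends; otherwise the robots that left the circle return to it. -/
noncomputable def observe (m : Memory) (c : Plane) (d : ℝ) (P : Finset Plane) (x : Plane) :
    Memory × Plane :=
  if numOnCircle c d P = 1 then
    ({ m with stage := .ended, home := none, leader := decide (dist x c = d) }, x)
  else
    ({ m with stage := .retry, home := none }, m.home.getD x)

/-- The leader election algorithm. The map `step` tells where an unsuccessful robot moves,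
depending on the robots it sees and on its own position. -/
noncomputable def leaderElection (step : Finset Plane → Plane → Plane) : Algorithm Memory where
  init := ⟨.start, 0, none, none, false⟩
  compute m P x u :=
    match m.stage, m.circle with
    | .start, _ => flip step { m with count := P.card } (center P) (radius P) P x u
    | .observe, some (c, d) => observe m c d P x
    | .retry, some (c, d) => flip step m c d P x u
    | _, _ => (m, x)

/-- A rule for the steps of unsuccessful robots: from any position on the (nondegenerate) circle,
move strictly inside the circle, by at most `ρ P`. -/
def IsInwardStep (ρ : Finset Plane → ℝ) (step : Finset Plane → Plane → Plane) : Prop :=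
  ∀ P : Finset Plane, ∀ x ∈ P, 0 < radius P → dist x (center P) = radius P →
    dist (step P x) (center P) < radius P ∧ dist (step P x) x ≤ ρ P

open Classical in
/-- The set of all positions of a configuration. -/
noncomputable def positions {n : ℕ} (pos : Fin n → Plane) : Finset Plane := Finset.univ.image pos

/-- The phase has ended with an elected leader: all robots have stored that the phase has ended;
one robot has stored that it is the leader, and it is on the circle of the initial configuration
`pos₀`; all others have stored that they are not the leader, and are strictly inside. -/
def Elected {n : ℕ} (pos₀ : Fin n → Plane) (s : State Memory n) : Prop :=
  (∀ i, (s.mem i).stage = .ended) ∧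
  ∃ l, (s.mem l).leader = true ∧
    dist (s.pos l) (center (positions pos₀)) = radius (positions pos₀) ∧
    ∀ j, j ≠ l → (s.mem j).leader = false ∧
      dist (s.pos j) (center (positions pos₀)) < radius (positions pos₀)

/-- The contents of a constant number of units of memory. -/
inductive Datum
  | integer (m : ℕ)
  | location (x : Plane)
  | length (r : ℝ)

/-- All data that a robot stores. -/
noncomputable def Memory.contents (m : Memory) : List Datum :=
  [.integer m.stage.code, .integer m.count, .integer m.leader.toNat] ++
  (m.circle.elim [] fun z => [.location z.1, .length z.2]) ++
  (m.home.elim [] fun x => [.location x])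

/-- A datum of a robot with coordinate system `frame` that fits into a constant number of units of
memory: an integer of size `O(n)` (that is, `O(log n)` bits), the location of a robot in the
initial configuration `pos₀`, or the center or radius of its circle. -/
def Datum.Fits (K : ℕ) {n : ℕ} (frame : Plane ≃ᵃⁱ[ℝ] Plane) (pos₀ : Fin n → Plane) :
    Datum → Prop
  | .integer m => m ≤ K * n
  | .location x => (∃ j, x = frame (pos₀ j)) ∨ x = frame (center (positions pos₀))
  | .length r => r = radius (positions pos₀)

/-- The memory uses at most `K` data, all of which fit. -/
def Memory.Fits (K : ℕ) {n : ℕ} (frame : Plane ≃ᵃⁱ[ℝ] Plane) (pos₀ : Fin n → Plane)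
    (m : Memory) : Prop :=
  m.contents.length ≤ K ∧ ∀ a ∈ m.contents, a.Fits K frame pos₀

end LeaderElection

end FatRobots

namespace FatRobots

/-! ### Mutual visibility is stable under reindexing, isometries and small perturbations -/

/-! Geometry: mutual visibility is an open condition on the tuple of centers, since each of its
finitely many clauses separates compact sets (`MutuallyVisible.eventually`). Hence some r > 0 allows
every robot to move by r independently, and `safeRadius` chooses such an r. Safety is a property of
the unlabelled set of positions, invariant under isometries, so all robots obtain the same threshold
from their private snapshots (`safeRadius_image`). Steps and returns never leave the balls of this
radius around the initial positions, so visibility is never lost.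

Dynamics: as everybody always sees everybody, all robots compute the same circle and the same
counts. A run therefore visits only four kinds of states (`reachable_run`), and the claims for all
coin outcomes are checked on these.

Probability: among k coins with success probability 1/k, exactly one succeeds with probability (1 -
1/k)^(k-1) ≥ 1/e, and then one robot remains on the circle. Independent iterations all fail N times
with probability at most (1 - 1/e)^N ≤ exp(-N/e), which is at most n^(-q) once N ≥ e q log n. -/

theorem MutuallyVisible.injective {n : ℕ} {pos : Fin n → Plane} (h : MutuallyVisible pos) :
    Function.Injective pos :=
  h.convexPosition.injective

/-- Covers a single robot: its circle has radius 0, and `IsInwardStep` then says nothing about its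
step. -/
theorem MutuallyVisible.of_subsingleton {n : ℕ} [Subsingleton (Fin n)] (pos : Fin n → Plane) :
    MutuallyVisible pos where
  collisionFree i j hij := absurd (Subsingleton.elim i j) hij
  convexPosition := convexIndependent_iff_notMem_convexHull_sdiff.2 fun i s => by
    have : s \ {i} = ∅ := by
      ext j
      simp [Subsingleton.elim j i]
    simp [this]
  visible i j hij := absurd (Subsingleton.elim i j) hij

theorem MutuallyVisible.comp_injective {m n : ℕ} {pos : Fin n → Plane} (h : MutuallyVisible pos)
    {σ : Fin m → Fin n} (hσ : Function.Injective σ) : MutuallyVisible (pos ∘ σ) where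
  collisionFree i j hij := h.collisionFree _ _ (hσ.ne hij)
  convexPosition := h.convexPosition.comp_embedding ⟨σ, hσ⟩
  visible i j hij := by
    obtain ⟨a, ha, b, hb, hab⟩ := h.visible _ _ (hσ.ne hij)
    exact ⟨a, ha, b, hb, fun k hki hkj => hab (σ k) (hσ.ne hki) (hσ.ne hkj)⟩

theorem image_body (f : Plane ≃ᵃⁱ[ℝ] Plane) (x : Plane) : f '' body x = body (f x) :=
  f.toIsometryEquiv.image_closedBall x _

theorem image_boundingCircle (f : Plane ≃ᵃⁱ[ℝ] Plane) (x : Plane) :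
    f '' boundingCircle x = boundingCircle (f x) :=
  f.toIsometryEquiv.image_sphere x _

theorem Sees.map {n : ℕ} {pos : Fin n → Plane} {i j : Fin n} (h : Sees pos i j)
    (f : Plane ≃ᵃⁱ[ℝ] Plane) : Sees (fun i => f (pos i)) i j := by
  obtain ⟨a, ha, b, hb, hab⟩ := h
  refine ⟨f a, image_boundingCircle f _ ▸ Set.mem_image_of_mem f ha,
    f b, image_boundingCircle f _ ▸ Set.mem_image_of_mem f hb, fun k hki hkj => ?_⟩
  have hseg : segment ℝ (f a) (f b) = f '' segment ℝ a b :=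
    (image_segment ℝ f.toAffineEquiv.toAffineMap a b).symm
  rw [hseg, ← image_body, Set.disjoint_image_iff f.injective]
  exact hab k hki hkj

theorem MutuallyVisible.map {n : ℕ} {pos : Fin n → Plane} (h : MutuallyVisible pos)
    (f : Plane ≃ᵃⁱ[ℝ] Plane) : MutuallyVisible fun i => f (pos i) where
  collisionFree i j hij := by
    rw [collide_iff, f.dist_map, ← collide_iff]
    exact h.collisionFree i j hij
  convexPosition := by
    have hc := h.convexPosition
    rw [convexIndependent_iff_notMem_convexHull_sdiff] at hc ⊢
    intro i s hi
    refine hc i s ?_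
    have himage : (fun i => f (pos i)) '' (s \ {i}) = f '' (pos '' (s \ {i})) := by
      rw [Set.image_image]
    have hhull : convexHull ℝ (f '' (pos '' (s \ {i}))) = f '' convexHull ℝ (pos '' (s \ {i})) :=
      (AffineMap.image_convexHull f.toAffineEquiv.toAffineMap _).symm
    rw [himage, hhull] at hi
    exact (f.injective.mem_set_image).1 hi
  visible i j hij := (h.visible i j hij).map f

/-- A corner has disjoint δ-thickenings from the compact hull of any other points. The thickened
hull is convex, so it contains the hull of the displaced points. -/
theorem eventually_convexIndependent {n : ℕ} {pos : Fin n → Plane}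
    (h : ConvexIndependent ℝ pos) : ∀ᶠ x in nhds pos, ConvexIndependent ℝ x := by
  simp_rw [convexIndependent_iff_notMem_convexHull_sdiff] at h ⊢
  refine Filter.eventually_all.2 fun i => Filter.eventually_all.2 fun s => ?_
  have hK : IsCompact (convexHull ℝ (pos '' (s \ {i}))) :=
    (((Set.toFinite _).image pos).isCompact_convexHull (𝕜 := ℝ))
  obtain ⟨δ, hδ, hdisj⟩ := (Set.disjoint_singleton_left.2 (h i s)).exists_cthickenings
    isCompact_singleton hK.isClosed
  filter_upwards [Metric.closedBall_mem_nhds pos hδ] with x hx hmem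
  have hx' : ∀ j, dist (x j) (pos j) ≤ δ := fun j => (dist_le_pi_dist x pos j).trans hx
  refine hdisj.le_bot ⟨Metric.mem_cthickening_of_dist_le _ _ _ _ rfl (hx' i), ?_⟩
  refine convexHull_min ?_ ((convex_convexHull ℝ _).cthickening δ) hmem
  rintro _ ⟨j, hj, rfl⟩
  exact Metric.mem_cthickening_of_dist_le _ _ _ _
    (subset_convexHull ℝ _ (Set.mem_image_of_mem pos hj)) (hx' j)

/-- The endpoints of the line of sight are carried along with their robots. The new segment stays in
a thickening of the old one, and each obstacle in a thickening of its old body; these are disjoint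
by compactness. -/
theorem eventually_sees {n : ℕ} {pos : Fin n → Plane} {i j : Fin n} (h : Sees pos i j) :
    ∀ᶠ x in nhds pos, Sees x i j := by
  obtain ⟨a, ha, b, hb, hab⟩ := h
  have hab' : ∀ k, ∃ δ, 0 < δ ∧ (k ≠ i → k ≠ j → Disjoint
      (Metric.cthickening δ (segment ℝ a b)) (Metric.cthickening δ (body (pos k)))) := by
    intro k
    by_cases hki : k = i
    · exact ⟨1, one_pos, fun h => absurd hki h⟩
    by_cases hkj : k = j
    · exact ⟨1, one_pos, fun _ h => absurd hkj h⟩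
    have hseg : IsCompact (segment ℝ a b) := by
      rw [segment_eq_image_lineMap]
      exact isCompact_Icc.image (by fun_prop)
    obtain ⟨δ, hδ, hd⟩ := (hab k hki hkj).exists_cthickenings hseg Metric.isClosed_closedBall
    exact ⟨δ, hδ, fun _ _ => hd⟩
  choose δ hδ hdisj using hab'
  have hball : ∀ᶠ x in nhds pos, ∀ k, dist x pos ≤ δ k :=
    Filter.eventually_all.2 fun k => Metric.closedBall_mem_nhds pos (hδ k)
  filter_upwards [hball] with x hx
  have hdist : ∀ k l, dist (x l) (pos l) ≤ δ k := fun k l => (dist_le_pi_dist x pos l).trans (hx k)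
  refine ⟨a + (x i - pos i), ?_, b + (x j - pos j), ?_, fun k hki hkj => ?_⟩
  · have : dist a (pos i) = 1 / 2 := ha
    change dist _ _ = _
    rw [← this, dist_eq_norm, dist_eq_norm]
    congr 1
    abel
  · have : dist b (pos j) = 1 / 2 := hb
    change dist _ _ = _
    rw [← this, dist_eq_norm, dist_eq_norm]
    congr 1
    abel
  · refine (hdisj k hki hkj).mono ?_ ?_
    · refine ((convex_segment a b).cthickening (δ k)).segment_subset ?_ ?_
      · refine Metric.mem_cthickening_of_dist_le _ a _ _ (left_mem_segment ℝ a b) ?_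
        rw [dist_self_add_left, ← dist_eq_norm]
        exact hdist k i
      · refine Metric.mem_cthickening_of_dist_le _ b _ _ (right_mem_segment ℝ a b) ?_
        rw [dist_self_add_left, ← dist_eq_norm]
        exact hdist k j
    · intro z hz
      have hz' : dist z (x k) ≤ 1 / 2 := hz
      -- Undoing the displacement of robot k takes z to a point of the old body.
      refine Metric.mem_cthickening_of_dist_le _ (z - (x k - pos k)) _ _ ?_ ?_
      · change dist _ _ ≤ _
        refine le_trans (le_of_eq ?_) hz'
        rw [dist_eq_norm, dist_eq_norm]
        congr 1
        abel
      · rw [dist_eq_norm, sub_sub_cancel, ← dist_eq_norm]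
        exact hdist k k

theorem MutuallyVisible.eventually {n : ℕ} {pos : Fin n → Plane} (h : MutuallyVisible pos) :
    ∀ᶠ x in nhds pos, MutuallyVisible x := by
  have hcol : ∀ᶠ x : Fin n → Plane in nhds pos, ∀ i j, i ≠ j → ¬ Collide (x i) (x j) := by
    refine Filter.eventually_all.2 fun i => Filter.eventually_all.2 fun j => ?_
    by_cases hij : i = j
    · exact Filter.Eventually.of_forall fun _ h => absurd hij h
    have hlt := h.collisionFree i j hij
    rw [collide_iff, not_le] at hlt
    have hcont : Continuous fun x : Fin n → Plane => dist (x i) (x j) := by fun_prop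
    filter_upwards [hcont.continuousAt.eventually (lt_mem_nhds hlt)] with x hx _
    rw [collide_iff, not_le]
    exact hx
  have hvis : ∀ᶠ x : Fin n → Plane in nhds pos, ∀ i j, i ≠ j → Sees x i j := by
    refine Filter.eventually_all.2 fun i => Filter.eventually_all.2 fun j => ?_
    by_cases hij : i = j
    · exact Filter.Eventually.of_forall fun _ h => absurd hij h
    filter_upwards [eventually_sees (h.visible i j hij)] with x hx _ using hx
  filter_upwards [hcol, eventually_convexIndependent h.convexPosition, hvis] with x h1 h2 h3
  exact ⟨h1, h2, h3⟩

/-! ### The threshold -/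

/-- Robots at the positions `P` remain mutually visible when each moves by at most `r`. -/
def IsSafe (P : Finset Plane) (r : ℝ) : Prop :=
  ∀ (n : ℕ) (pos x : Fin n → Plane), Function.Injective pos → positions pos = P →
    (∀ i, dist (x i) (pos i) ≤ r) → MutuallyVisible x

theorem mem_positions {n : ℕ} {pos : Fin n → Plane} {p : Plane} :
    p ∈ positions pos ↔ ∃ i, pos i = p := by
  simp [positions]

theorem positions_map {n : ℕ} (pos : Fin n → Plane) (f : Plane → Plane) :
    positions (fun i => f (pos i)) = (positions pos).image f := by
  ext p
  simp [positions]

theorem image_image_symm (P : Finset Plane) (f : Plane ≃ᵃⁱ[ℝ] Plane) :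
    (P.image f).image f.symm = P := by
  ext p
  simp

/-- Openness gives a radius for one labelling; any other injective labelling of the same set is
matched to it by an injection σ. -/
theorem MutuallyVisible.exists_isSafe {n : ℕ} {pos : Fin n → Plane} (h : MutuallyVisible pos) :
    ∃ r, 0 < r ∧ IsSafe (positions pos) r := by
  obtain ⟨r, hr, hball⟩ := Metric.nhds_basis_closedBall.eventually_iff.1 h.eventually
  refine ⟨r, hr, fun m pos' x hinj hpos hx => ?_⟩
  have hσ : ∀ i, ∃ j, pos j = pos' i := fun i =>
    mem_positions.1 (hpos ▸ mem_positions.2 ⟨i, rfl⟩)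
  choose σ hσ using hσ
  have hσinj : Function.Injective σ := fun i j hij => hinj (by rw [← hσ, ← hσ, hij])
  -- Indices outside the range of σ keep their positions, so surjectivity of σ need not be shown.
  have hy : MutuallyVisible (Function.extend σ x pos) := by
    refine hball ((dist_pi_le_iff hr.le).2 fun j => ?_)
    by_cases hj : ∃ i, σ i = j
    · obtain ⟨i, rfl⟩ := hj
      rw [hσinj.extend_apply, hσ]
      exact hx i
    · rw [Function.extend_apply' _ _ _ hj, dist_self]
      exact hr.le
  rw [← Function.extend_comp hσinj x pos]
  exact hy.comp_injective hσinj

theorem IsSafe.map {P : Finset Plane} {r : ℝ} (h : IsSafe P r) (f : Plane ≃ᵃⁱ[ℝ] Plane) :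
    IsSafe (P.image f) r := by
  intro n pos x hinj hpos hx
  have key : MutuallyVisible fun i => f.symm (x i) := by
    refine h n (fun i => f.symm (pos i)) _ (f.symm.injective.comp hinj) ?_ fun i => ?_
    · rw [positions_map, hpos, image_image_symm]
    · rw [f.symm.dist_map]
      exact hx i
  simpa using key.map f

theorem isSafe_image_iff {P : Finset Plane} {r : ℝ} (f : Plane ≃ᵃⁱ[ℝ] Plane) :
    IsSafe (P.image f) r ↔ IsSafe P r := by
  refine ⟨fun h => ?_, fun h => h.map f⟩
  have := h.map f.symm
  rwa [image_image_symm] at this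

/-- A distance by which robots at the positions `P` can safely move, if there is one. -/
noncomputable def safeRadius (P : Finset Plane) : ℝ :=
  Classical.epsilon fun r => 0 < r ∧ ((∃ r', 0 < r' ∧ IsSafe P r') → IsSafe P r)

/-- The implication makes the predicate satisfiable for every P, so the threshold is positive even
where no safe distance exists. -/
theorem safeRadius_spec (P : Finset Plane) :
    0 < safeRadius P ∧ ((∃ r', 0 < r' ∧ IsSafe P r') → IsSafe P (safeRadius P)) := by
  refine Classical.epsilon_spec (p := fun r => 0 < r ∧ ((∃ r', 0 < r' ∧ IsSafe P r') → IsSafe P r))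
    ?_
  by_cases h : ∃ r', 0 < r' ∧ IsSafe P r'
  · obtain ⟨r, hr, hs⟩ := h
    exact ⟨r, hr, fun _ => hs⟩
  · exact ⟨1, one_pos, fun h' => absurd h' h⟩

/-- The choice operator is applied to the same predicate on both sides, because safety is invariant
under isometries. -/
theorem safeRadius_image (P : Finset Plane) (f : Plane ≃ᵃⁱ[ℝ] Plane) :
    safeRadius (P.image f) = safeRadius P := by
  simp only [safeRadius, isSafe_image_iff]

theorem MutuallyVisible.of_dist_le_safeRadius {n : ℕ} {pos x : Fin n → Plane}
    (h : MutuallyVisible pos) (hx : ∀ i, dist (x i) (pos i) ≤ safeRadius (positions pos)) :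
    MutuallyVisible x :=
  (safeRadius_spec _).2 h.exists_isSafe n pos x h.injective rfl hx

/-! ### Coordinate systems -/

theorem center_image {P : Finset Plane} (hP : P.Nonempty) (f : Plane ≃ᵃⁱ[ℝ] Plane) :
    center (P.image f) = f (center P) := by
  have himage : P.image f = P.map ⟨f, f.injective⟩ := by
    ext p
    simp
  rw [center, center, himage, Finset.centroid_map, Finset.centroid_def, Finset.centroid_def]
  exact (Finset.map_affineCombination P id (P.centroidWeights ℝ)
    (P.sum_centroidWeights_eq_one_of_nonempty ℝ hP) f.toAffineEquiv.toAffineMap).symm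

theorem radius_image {P : Finset Plane} (hP : P.Nonempty) (f : Plane ≃ᵃⁱ[ℝ] Plane) :
    radius (P.image f) = radius P := by
  rw [radius, radius, center_image hP, Finset.sup_image]
  congr 2
  funext p
  exact f.isometry.nndist_eq _ _

theorem dist_center_le_radius {P : Finset Plane} {p : Plane} (hp : p ∈ P) :
    dist p (center P) ≤ radius P := by
  rw [radius, ← coe_nndist, NNReal.coe_le_coe]
  exact Finset.le_sup (f := fun p => nndist p (center P)) hp

theorem exists_dist_center_eq_radius {P : Finset Plane} (hP : P.Nonempty) :
    ∃ p ∈ P, dist p (center P) = radius P := by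
  obtain ⟨p, hp, h⟩ := Finset.exists_mem_eq_sup P hP fun p => nndist p (center P)
  exact ⟨p, hp, by rw [radius, h, coe_nndist]⟩

theorem numOnCircle_image (c : Plane) (d : ℝ) (P : Finset Plane) (f : Plane ≃ᵃⁱ[ℝ] Plane) :
    numOnCircle (f c) d (P.image f) = numOnCircle c d P := by
  classical
  rw [numOnCircle, numOnCircle, Finset.filter_image, Finset.card_image_of_injective _ f.injective]
  simp only [f.dist_map]

theorem numOnCircle_positions {n : ℕ} {pos : Fin n → Plane} (h : Function.Injective pos)
    (c : Plane) (d : ℝ) [DecidablePred fun i => dist (pos i) c = d] :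
    numOnCircle c d (positions pos) = (Finset.univ.filter fun i => dist (pos i) c = d).card := by
  classical
  rw [numOnCircle, positions, Finset.filter_image, Finset.card_image_of_injective _ h]
  congr

/-- Nothing is hidden, so the snapshots differ only by the coordinate systems; this is why the
robots' decisions agree. -/
theorem MutuallyVisible.snapshot_eq {n : ℕ} {pos : Fin n → Plane} (h : MutuallyVisible pos)
    (f : Plane ≃ᵃⁱ[ℝ] Plane) (i : Fin n) :
    snapshot f pos i = (positions pos).image f := by
  ext p
  simp only [snapshot, Finset.mem_image, Finset.mem_filter, Finset.mem_univ, true_and,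
    mem_positions]
  constructor
  · rintro ⟨j, -, rfl⟩
    exact ⟨_, ⟨j, rfl⟩, rfl⟩
  · rintro ⟨_, ⟨j, rfl⟩, rfl⟩
    exact ⟨j, or_iff_not_imp_left.2 fun hj => h.visible _ _ (Ne.symm hj), rfl⟩

/-! ### The reachable states -/

section Run

variable {n : ℕ} (step : Finset Plane → Plane → Plane) (frame : Fin n → Plane ≃ᵃⁱ[ℝ] Plane)
  (pos₀ : Fin n → Plane)

/-- Robot `i` is on the circle of the configuration. -/
def Competes (i : Fin n) : Prop :=
  dist (pos₀ i) (center (positions pos₀)) = radius (positions pos₀)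

/-- The number of competing robots. -/
noncomputable def numCompeting : ℕ :=
  numOnCircle (center (positions pos₀)) (radius (positions pos₀)) (positions pos₀)

/-- The coin of robot `i` succeeds. -/
def Succeeds (v : Fin n → ℝ) (i : Fin n) : Prop := v i ≤ 1 / (numCompeting pos₀ : ℝ)

/-- The memory of robot `i` after the first round. -/
noncomputable def memory (stage : Stage) (home : Option Plane) (leader : Bool) (i : Fin n) :
    Memory :=
  ⟨stage, (positions pos₀).card,
    some (frame i (center (positions pos₀)), radius (positions pos₀)), home, leader⟩

/-- The initial state. -/
def startState : State Memory n := ⟨pos₀, fun _ => ⟨.start, 0, none, none, false⟩⟩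

/-- The state after an iteration that failed. -/
noncomputable def retryState : State Memory n := ⟨pos₀, memory frame pos₀ .retry none false⟩

open Classical in
/-- The state after the coin flips `v`. -/
noncomputable def flipState (v : Fin n → ℝ) : State Memory n where
  pos i := if Competes pos₀ i ∧ ¬ Succeeds pos₀ v i then
    (frame i).symm (step ((positions pos₀).image (frame i)) (frame i (pos₀ i))) else pos₀ i
  mem i := memory frame pos₀ .observe
    (if Competes pos₀ i ∧ ¬ Succeeds pos₀ v i then some (frame i (pos₀ i)) else none) false i

/-- The number of robots on the circle after the coin flips `v`. -/
noncomputable def numRemaining (v : Fin n → ℝ) : ℕ :=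
  numOnCircle (center (positions pos₀)) (radius (positions pos₀))
    (positions (flipState step frame pos₀ v).pos)

open Classical in
/-- The final state after the coin flips `v`. -/
noncomputable def endState (v : Fin n → ℝ) : State Memory n where
  pos := (flipState step frame pos₀ v).pos
  mem i := memory frame pos₀ .ended none (decide (dist ((flipState step frame pos₀ v).pos i)
    (center (positions pos₀)) = radius (positions pos₀))) i

variable {step frame pos₀}

/-! ### Positions after the coin flips -/

theorem positions_nonempty (hn : 1 ≤ n) : (positions pos₀).Nonempty :=
  ⟨pos₀ ⟨0, hn⟩, mem_positions.2 ⟨_, rfl⟩⟩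

theorem radius_pos (hmv : MutuallyVisible pos₀) (hn : 2 ≤ n) : 0 < radius (positions pos₀) := by
  by_contra! hr
  have h : ∀ i, pos₀ i = center (positions pos₀) := fun i =>
    dist_le_zero.1 ((dist_center_le_radius (mem_positions.2 ⟨i, rfl⟩)).trans hr)
  have := hmv.injective ((h ⟨0, by omega⟩).trans (h ⟨1, by omega⟩).symm)
  simp at this

theorem flipState_pos_dist_center_lt (hstep : IsInwardStep safeRadius step)
    (hmv : MutuallyVisible pos₀) (hn : 2 ≤ n) {v : Fin n → ℝ} {i : Fin n}
    (hi : Competes pos₀ i ∧ ¬ Succeeds pos₀ v i) :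
    dist ((flipState step frame pos₀ v).pos i) (center (positions pos₀)) <
        radius (positions pos₀) ∧
      dist ((flipState step frame pos₀ v).pos i) (pos₀ i) ≤ safeRadius (positions pos₀) := by
  classical
  have hP := positions_nonempty (pos₀ := pos₀) (by omega : 1 ≤ n)
  have h := hstep ((positions pos₀).image (frame i)) (frame i (pos₀ i))
    (Finset.mem_image_of_mem _ (mem_positions.2 ⟨i, rfl⟩))
    (by rw [radius_image hP]; exact radius_pos hmv hn)
    (by rw [radius_image hP, center_image hP, (frame i).dist_map]; exact hi.1)
  rw [radius_image hP, center_image hP, safeRadius_image] at h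
  have hpos : (flipState step frame pos₀ v).pos i =
      (frame i).symm (step ((positions pos₀).image (frame i)) (frame i (pos₀ i))) := by
    simp only [flipState, if_pos hi]
  rw [hpos, ← (frame i).dist_map, ← (frame i).dist_map _ (pos₀ i), (frame i).apply_symm_apply]
  exact h

theorem flipState_pos_of_not {v : Fin n → ℝ} {i : Fin n}
    (hi : ¬ (Competes pos₀ i ∧ ¬ Succeeds pos₀ v i)) :
    (flipState step frame pos₀ v).pos i = pos₀ i := by
  simp only [flipState, if_neg hi]

theorem flipState_dist_center_le_radius (hstep : IsInwardStep safeRadius step)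
    (hmv : MutuallyVisible pos₀) (hn : 2 ≤ n) (v : Fin n → ℝ) (i : Fin n) :
    dist ((flipState step frame pos₀ v).pos i) (center (positions pos₀)) ≤
      radius (positions pos₀) := by
  by_cases hi : Competes pos₀ i ∧ ¬ Succeeds pos₀ v i
  · exact (flipState_pos_dist_center_lt hstep hmv hn hi).1.le
  · rw [flipState_pos_of_not hi]
    exact dist_center_le_radius (mem_positions.2 ⟨i, rfl⟩)

/-- Both ends of each segment lie in the safe ball around the initial position, which is convex. The
points are chosen independently, which allows for arbitrary relative speeds. -/
theorem mutuallyVisible_of_mem_segment (hstep : IsInwardStep safeRadius step)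
    (hmv : MutuallyVisible pos₀) {v : Fin n → ℝ} {x : Fin n → Plane}
    (hx : ∀ i, x i ∈ segment ℝ (pos₀ i) ((flipState step frame pos₀ v).pos i)) :
    MutuallyVisible x := by
  rcases Nat.lt_or_ge n 2 with hn | hn
  · have : Subsingleton (Fin n) := Fin.subsingleton_iff_le_one.2 (by omega)
    exact .of_subsingleton x
  refine hmv.of_dist_le_safeRadius fun i => ?_
  have hball : ∀ y ∈ segment ℝ (pos₀ i) ((flipState step frame pos₀ v).pos i),
      y ∈ Metric.closedBall (pos₀ i) (safeRadius (positions pos₀)) := by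
    refine (convex_closedBall _ _).segment_subset
      (Metric.mem_closedBall_self (safeRadius_spec _).1.le) ?_
    by_cases hi : Competes pos₀ i ∧ ¬ Succeeds pos₀ v i
    · exact (flipState_pos_dist_center_lt hstep hmv hn hi).2
    · rw [flipState_pos_of_not hi]
      exact Metric.mem_closedBall_self (safeRadius_spec _).1.le
  exact hball _ (hx i)

theorem mutuallyVisible_flipState (hstep : IsInwardStep safeRadius step)
    (hmv : MutuallyVisible pos₀) (v : Fin n → ℝ) :
    MutuallyVisible (flipState step frame pos₀ v).pos :=
  mutuallyVisible_of_mem_segment hstep hmv fun _ => right_mem_segment ℝ _ _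

/-! ### One round from each kind of state -/

theorem flip_eq_flipState {m : Memory} (hcount : m.count = (positions pos₀).card)
    (hleader : m.leader = false) (v : Fin n → ℝ) (i : Fin n) :
    flip step m (frame i (center (positions pos₀))) (radius (positions pos₀))
        ((positions pos₀).image (frame i)) (frame i (pos₀ i)) (v i) =
      ((flipState step frame pos₀ v).mem i, frame i ((flipState step frame pos₀ v).pos i)) := by
  have hcond : (dist (frame i (pos₀ i)) (frame i (center (positions pos₀))) =
        radius (positions pos₀) ∧
      ¬ v i ≤ 1 / (numOnCircle (frame i (center (positions pos₀))) (radius (positions pos₀))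
        ((positions pos₀).image (frame i)) : ℝ)) ↔ Competes pos₀ i ∧ ¬ Succeeds pos₀ v i := by
    rw [(frame i).dist_map, numOnCircle_image]
    rfl
  unfold flip
  by_cases hi : Competes pos₀ i ∧ ¬ Succeeds pos₀ v i
  · rw [if_pos (hcond.2 hi)]
    simp only [flipState, if_pos hi, memory, (frame i).apply_symm_apply, hcount, hleader]
  · rw [if_neg (mt hcond.1 hi)]
    simp only [flipState, if_neg hi, memory, hcount, hleader]

theorem State.eq_of_forall {M : Type} {s t : State M n} (hpos : ∀ i, s.pos i = t.pos i)
    (hmem : ∀ i, s.mem i = t.mem i) : s = t := by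
  cases s
  cases t
  congr
  · exact funext hpos
  · exact funext hmem

theorem round_eq_of_compute_eq {M : Type} {A : Algorithm M} {v : Fin n → ℝ} {s t : State M n}
    (h : ∀ i, A.compute (s.mem i) (snapshot (frame i) s.pos i) (frame i (s.pos i)) (v i) =
      (t.mem i, frame i (t.pos i))) : A.round frame v s = t :=
  State.eq_of_forall (fun i => by simp only [Algorithm.round, h, (frame i).symm_apply_apply])
    (fun i => by simp only [Algorithm.round, h])

theorem round_startState (hn : 1 ≤ n) (hmv : MutuallyVisible pos₀) (v : Fin n → ℝ) :
    (leaderElection step).round frame v (startState pos₀) = flipState step frame pos₀ v := by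
  classical
  have hP := positions_nonempty (pos₀ := pos₀) hn
  refine round_eq_of_compute_eq fun i => ?_
  simp only [leaderElection, startState]
  rw [hmv.snapshot_eq, center_image hP, radius_image hP]
  refine flip_eq_flipState ?_ rfl v i
  exact Finset.card_image_of_injective (positions pos₀) (frame i).injective

theorem round_retryState (hmv : MutuallyVisible pos₀) (v : Fin n → ℝ) :
    (leaderElection step).round frame v (retryState frame pos₀) = flipState step frame pos₀ v := by
  classical
  refine round_eq_of_compute_eq fun i => ?_
  simp only [leaderElection, retryState, memory]
  rw [hmv.snapshot_eq]
  exact flip_eq_flipState rfl rfl v i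

theorem round_endState (v w : Fin n → ℝ) :
    (leaderElection step).round frame w (endState step frame pos₀ v) =
      endState step frame pos₀ v :=
  round_eq_of_compute_eq fun i => by simp only [leaderElection, endState, memory]

theorem compute_flipState (hstep : IsInwardStep safeRadius step) (hmv : MutuallyVisible pos₀)
    (v w : Fin n → ℝ) (i : Fin n) :
    (leaderElection step).compute ((flipState step frame pos₀ v).mem i)
        (snapshot (frame i) (flipState step frame pos₀ v).pos i)
        (frame i ((flipState step frame pos₀ v).pos i)) (w i) =
      observe ((flipState step frame pos₀ v).mem i) (frame i (center (positions pos₀)))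
        (radius (positions pos₀)) ((positions (flipState step frame pos₀ v).pos).image (frame i))
        (frame i ((flipState step frame pos₀ v).pos i)) := by
  rw [(mutuallyVisible_flipState hstep hmv v).snapshot_eq]
  rfl

theorem round_flipState_of_numRemaining_eq (hstep : IsInwardStep safeRadius step)
    (hmv : MutuallyVisible pos₀) {v : Fin n → ℝ} (hv : numRemaining step frame pos₀ v = 1)
    (w : Fin n → ℝ) :
    (leaderElection step).round frame w (flipState step frame pos₀ v) =
      endState step frame pos₀ v := by
  classical
  refine round_eq_of_compute_eq fun i => ?_
  rw [compute_flipState hstep hmv, observe, numOnCircle_image, ← numRemaining, if_pos hv,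
    (frame i).dist_map]
  rfl

theorem round_flipState_of_numRemaining_ne (hstep : IsInwardStep safeRadius step)
    (hmv : MutuallyVisible pos₀) {v : Fin n → ℝ} (hv : numRemaining step frame pos₀ v ≠ 1)
    (w : Fin n → ℝ) :
    (leaderElection step).round frame w (flipState step frame pos₀ v) =
      retryState frame pos₀ := by
  classical
  refine round_eq_of_compute_eq fun i => ?_
  rw [compute_flipState hstep hmv, observe, numOnCircle_image, ← numRemaining, if_neg hv]
  by_cases hi : Competes pos₀ i ∧ ¬ Succeeds pos₀ v i
  · simp [flipState, retryState, memory, hi]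
  -- A robot that stayed has no stored home; the default value of `getD` is its present, hence
  -- initial, position.
  · simp only [flipState, retryState, memory, if_neg hi, Option.getD_none]

/-- The states that a run can reach. -/
inductive Reachable (step : Finset Plane → Plane → Plane) (frame : Fin n → Plane ≃ᵃⁱ[ℝ] Plane)
    (pos₀ : Fin n → Plane) : State Memory n → Prop
  | start : Reachable step frame pos₀ (startState pos₀)
  | flip (v : Fin n → ℝ) : Reachable step frame pos₀ (flipState step frame pos₀ v)
  | retry : Reachable step frame pos₀ (retryState frame pos₀)
  | ended (v : Fin n → ℝ) (hv : numRemaining step frame pos₀ v = 1) :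
      Reachable step frame pos₀ (endState step frame pos₀ v)

/-- The four kinds are closed under a round: start and retry lead to a flip, a flip to ended or
retry according to the count, and ended is fixed. -/
theorem reachable_run (hn : 1 ≤ n) (hstep : IsInwardStep safeRadius step)
    (hmv : MutuallyVisible pos₀) (u : ℕ → Fin n → ℝ) (t : ℕ) :
    Reachable step frame pos₀ ((leaderElection step).run frame pos₀ u t) := by
  induction t with
  | zero => exact .start
  | succ t ih =>
    rw [Algorithm.run]
    generalize (leaderElection step).run frame pos₀ u t = s at ih
    cases ih with
    | start => exact round_startState hn hmv (u t) ▸ .flip _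
    | retry => exact round_retryState hmv (u t) ▸ .flip _
    | ended v hv => exact (round_endState v (u t)).symm ▸ .ended v hv
    | flip v =>
      by_cases hv : numRemaining step frame pos₀ v = 1
      · exact round_flipState_of_numRemaining_eq hstep hmv hv (u t) ▸ .ended v hv
      · exact round_flipState_of_numRemaining_ne hstep hmv hv (u t) ▸ .retry

theorem Reachable.mutuallyVisible_of_mem_segment (hn : 1 ≤ n)
    (hstep : IsInwardStep safeRadius step) (hmv : MutuallyVisible pos₀) {s : State Memory n}
    (hs : Reachable step frame pos₀ s) (w : Fin n → ℝ) {x : Fin n → Plane}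
    (hx : ∀ i, x i ∈ segment ℝ (s.pos i) (((leaderElection step).round frame w s).pos i)) :
    MutuallyVisible x := by
  have hconst : ∀ v, (∀ i, x i ∈ segment ℝ ((flipState step frame pos₀ v).pos i)
      ((flipState step frame pos₀ v).pos i)) → MutuallyVisible x := by
    intro v h
    simp only [segment_same, Set.mem_singleton_iff] at h
    rw [show x = (flipState step frame pos₀ v).pos from funext h]
    exact mutuallyVisible_flipState hstep hmv v
  cases hs with
  | start =>
    rw [round_startState hn hmv] at hx
    exact FatRobots.mutuallyVisible_of_mem_segment hstep hmv hx
  | retry =>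
    rw [round_retryState hmv] at hx
    exact FatRobots.mutuallyVisible_of_mem_segment hstep hmv hx
  | ended v hv =>
    rw [round_endState] at hx
    exact hconst v hx
  | flip v =>
    by_cases hv : numRemaining step frame pos₀ v = 1
    · rw [round_flipState_of_numRemaining_eq hstep hmv hv] at hx
      exact hconst v hx
    · rw [round_flipState_of_numRemaining_ne hstep hmv hv] at hx
      -- The way back runs through the outgoing segments in reverse.
      refine FatRobots.mutuallyVisible_of_mem_segment (frame := frame) hstep hmv (v := v) fun i => ?_
      rw [segment_symm]
      exact hx i

theorem elected_endState (hn : 1 ≤ n) (hstep : IsInwardStep safeRadius step)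
    (hmv : MutuallyVisible pos₀) {v : Fin n → ℝ} (hv : numRemaining step frame pos₀ v = 1) :
    Elected pos₀ (endState step frame pos₀ v) := by
  classical
  refine ⟨fun i => rfl, ?_⟩
  rw [numRemaining, numOnCircle_positions (mutuallyVisible_flipState hstep hmv v).injective,
    Finset.card_eq_one] at hv
  obtain ⟨l, hl⟩ := hv
  have hmem : ∀ j, dist ((flipState step frame pos₀ v).pos j) (center (positions pos₀)) =
      radius (positions pos₀) ↔ j = l := by
    intro j
    rw [← Finset.mem_singleton (a := l), ← hl]
    simp
  refine ⟨l, decide_eq_true ((hmem l).2 rfl), (hmem l).2 rfl, fun j hj => ?_⟩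
  refine ⟨decide_eq_false (mt (hmem j).1 hj), lt_of_le_of_ne ?_ (mt (hmem j).1 hj)⟩
  refine flipState_dist_center_le_radius hstep hmv ?_ v j
  -- The bound needs at least two robots, which j ≠ l supplies.
  by_contra! hlt
  exact hj (Fin.ext (by omega))

theorem Reachable.elected_of_ended (hn : 1 ≤ n) (hstep : IsInwardStep safeRadius step)
    (hmv : MutuallyVisible pos₀) {s : State Memory n} (hs : Reachable step frame pos₀ s)
    {i : Fin n} (hi : (s.mem i).stage = .ended) (w : Fin n → ℝ) :
    Elected pos₀ s ∧ (leaderElection step).round frame w s = s := by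
  cases hs with
  | start => cases hi
  | retry => cases hi
  | flip v => cases hi
  | ended v hv => exact ⟨elected_endState hn hstep hmv hv, round_endState v w⟩

theorem memory_fits {stage : Stage} {home : Option Plane} {leader : Bool} {i : Fin n}
    (hhome : home = none ∨ home = some (frame i (pos₀ i))) :
    (memory frame pos₀ stage home leader i).Fits 6 (frame i) pos₀ := by
  classical
  have hn : 1 ≤ n := i.pos
  have hcard : (positions pos₀).card ≤ n := by
    simpa [positions] using Finset.card_image_le (s := Finset.univ) (f := pos₀)
  have hcode : stage.code ≤ 3 := by cases stage <;> simp [Stage.code]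
  have hleader : leader.toNat ≤ 1 := by cases leader <;> simp
  rcases hhome with rfl | rfl
  · refine ⟨by simp [memory, Memory.contents], fun a ha => ?_⟩
    simp only [memory, Memory.contents, Option.elim, List.mem_append, List.mem_cons,
      List.not_mem_nil, or_false] at ha
    rcases ha with (rfl | rfl | rfl) | rfl | rfl
    · exact hcode.trans (by omega)
    · exact hcard.trans (by omega)
    · exact hleader.trans (by omega)
    · exact Or.inr rfl
    · rfl
  · refine ⟨by simp [memory, Memory.contents], fun a ha => ?_⟩
    simp only [memory, Memory.contents, Option.elim, List.mem_append, List.mem_cons,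
      List.not_mem_nil, or_false] at ha
    rcases ha with ((rfl | rfl | rfl) | rfl | rfl) | rfl
    · exact hcode.trans (by omega)
    · exact hcard.trans (by omega)
    · exact hleader.trans (by omega)
    · exact Or.inr rfl
    · rfl
    · exact Or.inl ⟨i, rfl⟩

theorem Reachable.memory_fits {s : State Memory n} (hs : Reachable step frame pos₀ s)
    (i : Fin n) : (s.mem i).Fits 6 (frame i) pos₀ := by
  classical
  cases hs with
  | start => simp [startState, Memory.Fits, Memory.contents, Datum.Fits, Stage.code]
  | retry => exact FatRobots.memory_fits (.inl rfl)
  | ended v hv => exact FatRobots.memory_fits (.inl rfl)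
  | flip v =>
    refine FatRobots.memory_fits ?_
    by_cases hi : Competes pos₀ i ∧ ¬ Succeeds pos₀ v i
    · exact .inr (if_pos hi)
    · exact .inl (if_neg hi)

/-! ### A unique success ends the phase -/

theorem numRemaining_eq_one (hstep : IsInwardStep safeRadius step) (hmv : MutuallyVisible pos₀)
    (hn : 2 ≤ n) {v : Fin n → ℝ} (hv : ∃! i, Competes pos₀ i ∧ Succeeds pos₀ v i) :
    numRemaining step frame pos₀ v = 1 := by
  classical
  obtain ⟨l, ⟨hl, hlv⟩, huniq⟩ := hv
  rw [numRemaining, numOnCircle_positions (mutuallyVisible_flipState hstep hmv v).injective,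
    Finset.card_eq_one]
  refine ⟨l, ?_⟩
  ext j
  simp only [Finset.mem_filter, Finset.mem_univ, true_and, Finset.mem_singleton]
  constructor
  · intro h
    by_cases hj : Competes pos₀ j ∧ ¬ Succeeds pos₀ v j
    · exact absurd h (flipState_pos_dist_center_lt hstep hmv hn hj).1.ne
    · rw [flipState_pos_of_not hj] at h
      exact huniq j ⟨h, not_not.1 fun hs => hj ⟨h, hs⟩⟩
  · rintro rfl
    rw [flipState_pos_of_not fun h => h.2 hlv]
    exact hl

/-- After an even number of rounds, an iteration begins or the phase has ended. -/
theorem run_two_mul (hn : 1 ≤ n) (hstep : IsInwardStep safeRadius step)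
    (hmv : MutuallyVisible pos₀) (u : ℕ → Fin n → ℝ) (m : ℕ) :
    (∀ w, (leaderElection step).round frame w ((leaderElection step).run frame pos₀ u (2 * m)) =
      flipState step frame pos₀ w) ∨
    ∃ v, numRemaining step frame pos₀ v = 1 ∧
      (leaderElection step).run frame pos₀ u (2 * m) = endState step frame pos₀ v := by
  induction m with
  | zero => exact .inl fun w => round_startState hn hmv w
  | succ m ih =>
    rw [show 2 * (m + 1) = 2 * m + 1 + 1 by ring, Algorithm.run, Algorithm.run]
    rcases ih with h | ⟨v, hv, h⟩
    · rw [h]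
      by_cases hv : numRemaining step frame pos₀ (u (2 * m)) = 1
      · exact .inr ⟨_, hv, round_flipState_of_numRemaining_eq hstep hmv hv _⟩
      · rw [round_flipState_of_numRemaining_ne hstep hmv hv]
        exact .inl fun w => round_retryState hmv w
    · rw [h, round_endState, round_endState]
      exact .inr ⟨v, hv, rfl⟩

/-- If the phase ended earlier, its final state persists, so the coins need no conditioning on the
phase still running. -/
theorem elected_run_of_unique (hn : 2 ≤ n) (hstep : IsInwardStep safeRadius step)
    (hmv : MutuallyVisible pos₀) {u : ℕ → Fin n → ℝ} {m : ℕ}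
    (hu : ∃! i, Competes pos₀ i ∧ Succeeds pos₀ (u (2 * m)) i) :
    Elected pos₀ ((leaderElection step).run frame pos₀ u (2 * m + 2)) := by
  have hn1 : 1 ≤ n := by omega
  rw [Algorithm.run, Algorithm.run]
  rcases run_two_mul (frame := frame) hn1 hstep hmv u m with h | ⟨v, hv, h⟩
  · have hv := numRemaining_eq_one (frame := frame) hstep hmv hn hu
    rw [h, round_flipState_of_numRemaining_eq hstep hmv hv]
    exact elected_endState hn1 hstep hmv hv
  · rw [h, round_endState, round_endState]
    exact elected_endState hn1 hstep hmv hv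

end Run

/-! ### Independent trials -/

/-- The first N trials and the next one depend on disjoint blocks of coordinates, so one factor r
splits off per trial. -/
theorem measure_forall_lt_le_pow {n : ℕ} {Ω : Type*} [MeasurableSpace Ω] {μ : Measure Ω}
    [IsProbabilityMeasure μ] {V : ℕ → Fin n → Ω → ℝ} (hV : ∀ t i, Measurable (V t i))
    (hind : iIndepFun (fun a : ℕ × Fin n => V a.1 a.2) μ)
    {B : Set (Fin n → ℝ)} (hB : MeasurableSet B) {r : ENNReal}
    (hr : ∀ t, μ {ω | (fun i => V t i ω) ∈ B} ≤ r) (N : ℕ) :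
    μ {ω | ∀ t < N, (fun i => V t i ω) ∈ B} ≤ r ^ N := by
  induction N with
  | zero => simp
  | succ N ih =>
    let S : Finset (ℕ × Fin n) := Finset.range N ×ˢ Finset.univ
    let T : Finset (ℕ × Fin n) := {N} ×ˢ Finset.univ
    have hST : Disjoint S T := by
      rw [Finset.disjoint_left]
      rintro ⟨t, i⟩ h1 h2
      simp only [S, T, Finset.mem_product, Finset.mem_range, Finset.mem_singleton] at h1 h2
      omega
    have hindep := hind.indepFun_finset S T hST fun a => hV a.1 a.2
    have hS : ∀ t : Fin N, ∀ i : Fin n, ((t : ℕ), i) ∈ S := fun t i => by simp [S]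
    have hT : ∀ i : Fin n, (N, i) ∈ T := fun i => by simp [T]
    let s : Set (S → ℝ) := ⋂ t : Fin N, (fun x i => x ⟨(t, i), hS t i⟩) ⁻¹' B
    let t : Set (T → ℝ) := (fun x i => x ⟨(N, i), hT i⟩) ⁻¹' B
    have hs : MeasurableSet s := MeasurableSet.iInter fun t =>
      measurableSet_preimage (measurable_pi_lambda _ fun i => measurable_pi_apply _) hB
    have ht : MeasurableSet t :=
      measurableSet_preimage (measurable_pi_lambda _ fun i => measurable_pi_apply _) hB
    have hmul := hindep.measure_inter_preimage_eq_mul s t hs ht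
    have h1 : {ω | ∀ t < N, (fun i => V t i ω) ∈ B} =
        (fun ω (a : S) => V a.1.1 a.1.2 ω) ⁻¹' s := by
      ext ω
      simp only [s, Set.mem_ofPred_eq, Set.mem_preimage, Set.mem_iInter]
      exact ⟨fun h t => h t t.2, fun h t ht => h ⟨t, ht⟩⟩
    have h2 : {ω | (fun i => V N i ω) ∈ B} = (fun ω (a : T) => V a.1.1 a.1.2 ω) ⁻¹' t := rfl
    have h3 : {ω | ∀ t < N + 1, (fun i => V t i ω) ∈ B} =
        {ω | ∀ t < N, (fun i => V t i ω) ∈ B} ∩ {ω | (fun i => V N i ω) ∈ B} := by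
      ext ω
      simp only [Set.mem_ofPred_eq, Set.mem_inter_iff]
      exact Nat.forall_lt_succ_right
    rw [h3, h1, h2, hmul, ← h1, ← h2, pow_succ]
    exact mul_le_mul' ih (hr N)

/-- For k > 0 the right side equals (1 + 1/k)^(-k), and (1 + 1/k)^k ≤ e. For k = 0 it is 0^0 = 1. -/
theorem exp_neg_one_le_one_sub_inv_pow (k : ℕ) :
    Real.exp (-1) ≤ (1 - 1 / ((k + 1 : ℕ) : ℝ)) ^ k := by
  rcases Nat.eq_zero_or_pos k with rfl | hk
  · simp
  have hk' : (0 : ℝ) < k := by exact_mod_cast hk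
  have h : (1 - 1 / ((k + 1 : ℕ) : ℝ)) = (1 + (k : ℝ)⁻¹)⁻¹ := by
    push_cast
    field_simp
    ring
  rw [h, inv_pow, Real.exp_neg]
  exact inv_anti₀ (by positivity) Real.one_add_inv_pow_le_exp

theorem measureReal_uniform_le {Ω : Type*} [MeasurableSpace Ω] {μ : Measure Ω} {X : Ω → ℝ}
    (hX : pdf.IsUniform X (Set.Icc 0 1) μ) {a : ℝ} (h0 : 0 ≤ a) (h1 : a ≤ 1) :
    μ.real (X ⁻¹' Set.Iic a) = a := by
  have h := hX.measure_preimage (by simp) (by simp) (measurableSet_Iic (a := a))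
  have hinter : Set.Icc (0 : ℝ) 1 ∩ Set.Iic a = Set.Icc 0 a := by
    ext x
    simp only [Set.mem_inter_iff, Set.mem_Icc, Set.mem_Iic]
    exact ⟨fun h => ⟨h.1.1, h.2⟩, fun h => ⟨⟨h.1, h.2.trans h1⟩, h.2⟩⟩
  rw [measureReal_def, h, hinter]
  simp [h0]

/-- Among independent coins with success probability `1 / #S`, exactly one succeeds with probability
at least `1 / e`. -/
theorem exp_neg_one_le_measureReal_unique {n : ℕ} {Ω : Type*} [MeasurableSpace Ω] {μ : Measure Ω}
    [IsProbabilityMeasure μ] {X : Fin n → Ω → ℝ} (hX : ∀ i, Measurable (X i))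
    (hunif : ∀ i, pdf.IsUniform (X i) (Set.Icc 0 1) μ) (hind : iIndepFun X μ)
    {S : Finset (Fin n)} (hS : S.Nonempty) :
    Real.exp (-1) ≤ μ.real {ω | ∃! i, i ∈ S ∧ X i ω ≤ 1 / (S.card : ℝ)} := by
  obtain ⟨k, hk⟩ : ∃ k, S.card = k + 1 := Nat.exists_eq_succ_of_ne_zero hS.card_ne_zero
  rw [hk]
  set p : ℝ := 1 / ((k + 1 : ℕ) : ℝ) with hp
  have hp0 : 0 ≤ p := by positivity
  have hp1 : p ≤ 1 := by
    rw [hp, div_le_one (by positivity)]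
    push_cast
    linarith [(Nat.cast_nonneg k : (0 : ℝ) ≤ k)]
  -- `E j`, the event that j alone succeeds within S, is an intersection of one condition per coin;
  -- these events are disjoint and partition the wanted one.
  let A : Fin n → Fin n → Set ℝ := fun j i => if i = j then Set.Iic p else Set.Ioi p
  have hA : ∀ j i, MeasurableSet (A j i) := fun j i => by
    by_cases h : i = j <;> simp [A, h]
  let E : Fin n → Set Ω := fun j => ⋂ i ∈ S, X i ⁻¹' A j i
  have hEm : ∀ j, MeasurableSet (E j) := fun j =>
    Finset.measurableSet_biInter _ fun i _ => hX i (hA j i)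
  have hmem : ∀ j ∈ S, ∀ ω, ω ∈ E j ↔ X j ω ≤ p ∧ ∀ i ∈ S, i ≠ j → p < X i ω := by
    intro j hj ω
    simp only [E, A, Set.mem_iInter, Set.mem_preimage]
    constructor
    · intro h
      refine ⟨by simpa using h j hj, fun i hi hij => by simpa [hij] using h i hi⟩
    · rintro ⟨h1, h2⟩ i hi
      by_cases hij : i = j
      · simpa [hij] using h1
      · simpa [hij] using h2 i hi hij
  have hprob : ∀ j ∈ S, μ.real (E j) = p * (1 - p) ^ k := by
    intro j hj
    have hmul := hind.measure_inter_preimage_eq_mul S (sets := A j) fun i _ => hA j i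
    have hcompl : ∀ i, μ.real (X i ⁻¹' Set.Ioi p) = 1 - p := by
      intro i
      have : X i ⁻¹' Set.Ioi p = (X i ⁻¹' Set.Iic p)ᶜ := by
        rw [← Set.preimage_compl, Set.compl_Iic]
      rw [this, probReal_compl_eq_one_sub (hX i measurableSet_Iic),
        measureReal_uniform_le (hunif i) hp0 hp1]
    rw [measureReal_def, hmul, ENNReal.toReal_prod, ← Finset.mul_prod_erase S _ hj]
    congr 1
    · simpa [A, measureReal_def] using measureReal_uniform_le (hunif j) hp0 hp1
    · rw [Finset.prod_congr rfl (g := fun _ => 1 - p), Finset.prod_const,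
        Finset.card_erase_of_mem hj, hk, Nat.add_sub_cancel]
      intro i hi
      simpa [A, measureReal_def, Finset.ne_of_mem_erase hi] using hcompl i
  have hdisj : Set.PairwiseDisjoint (S : Set (Fin n)) E := by
    intro i hi j hj hij
    refine Set.disjoint_left.2 fun ω h1 h2 => ?_
    rw [hmem i hi] at h1
    rw [hmem j hj] at h2
    exact absurd h1.1 (not_le.2 (h2.2 i hi hij))
  calc Real.exp (-1) ≤ (1 - p) ^ k := exp_neg_one_le_one_sub_inv_pow k
    _ = ∑ j ∈ S, μ.real (E j) := by
        rw [Finset.sum_congr rfl hprob, Finset.sum_const, hk, nsmul_eq_mul, ← mul_assoc, hp,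
          mul_one_div_cancel (by positivity), one_mul]
    _ = μ.real (⋃ j ∈ S, E j) :=
        (measureReal_biUnion_finset hdisj fun j _ => hEm j).symm
    _ ≤ _ := by
        refine measureReal_mono ?_
        intro ω hω
        simp only [Set.mem_iUnion] at hω
        obtain ⟨j, hj, hjω⟩ := hω
        rw [hmem j hj] at hjω
        refine ⟨j, ⟨hj, hjω.1⟩, fun i hi => ?_⟩
        by_contra hij
        exact absurd hi.2 (not_le.2 (hjω.2 i hi.1 hij))

/-- In `N ≥ e * q * log n` independent iterations, at least one has exactly one success. -/
theorem one_sub_rpow_neg_le_measureReal_exists_unique {n : ℕ} (hn : 1 ≤ n) {Ω : Type*}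
    [MeasurableSpace Ω] {μ : Measure Ω} [IsProbabilityMeasure μ] {V : ℕ → Fin n → Ω → ℝ}
    (hV : ∀ t i, Measurable (V t i)) (hunif : ∀ t i, pdf.IsUniform (V t i) (Set.Icc 0 1) μ)
    (hind : iIndepFun (fun a : ℕ × Fin n => V a.1 a.2) μ)
    {S : Finset (Fin n)} (hS : S.Nonempty) {q : ℝ} {N : ℕ}
    (hN : Real.exp 1 * q * Real.log n ≤ N) :
    1 - (n : ℝ) ^ (-q) ≤
      μ.real {ω | ∃ t < N, ∃! i, i ∈ S ∧ V t i ω ≤ 1 / (S.card : ℝ)} := by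
  let G : Set (Fin n → ℝ) := {x | ∃! i, i ∈ S ∧ x i ≤ 1 / (S.card : ℝ)}
  have hG : MeasurableSet G := by
    -- Unique existence becomes a finite union of visibly measurable sets.
    have : G = ⋃ i, {x | (i ∈ S ∧ x i ≤ 1 / (S.card : ℝ)) ∧
        ∀ j, j ∈ S ∧ x j ≤ 1 / (S.card : ℝ) → j = i} := by
      ext x
      simp [G, ExistsUnique]
    rw [this]
    measurability
  have hpre : ∀ t, Measurable fun ω i => V t i ω := fun t => measurable_pi_lambda _ (hV t)
  -- The failure probability 1 - 1/e is relaxed to exp(-1/e), whose powers compare directly with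
  -- n^(-q).
  have hfail : ∀ t, μ {ω | (fun i => V t i ω) ∈ Gᶜ} ≤
      ENNReal.ofReal (Real.exp (-Real.exp (-1))) := by
    intro t
    have hsucc := exp_neg_one_le_measureReal_unique (hV t) (hunif t)
      (hind.precomp (g := fun i => (t, i)) (Prod.mk_right_injective t)) hS
    rw [← ENNReal.ofReal_toReal (measure_ne_top μ _)]
    refine ENNReal.ofReal_le_ofReal ?_
    have hc : μ.real ((fun ω i => V t i ω) ⁻¹' G)ᶜ = 1 - μ.real ((fun ω i => V t i ω) ⁻¹' G) :=
      probReal_compl_eq_one_sub (hpre t hG)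
    change μ.real ((fun ω i => V t i ω) ⁻¹' G)ᶜ ≤ _
    rw [hc]
    refine le_trans ?_ (Real.one_sub_le_exp_neg _)
    exact sub_le_sub_left hsucc _
  have hall := measure_forall_lt_le_pow hV hind hG.compl hfail N
  have hset : {ω | ∃ t < N, ∃! i, i ∈ S ∧ V t i ω ≤ 1 / (S.card : ℝ)} =
      {ω | ∀ t < N, (fun i => V t i ω) ∈ Gᶜ}ᶜ := by
    ext ω
    simp [G]
  have hmeas : MeasurableSet {ω | ∀ t < N, (fun i => V t i ω) ∈ Gᶜ} := by
    have : {ω | ∀ t < N, (fun i => V t i ω) ∈ Gᶜ} =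
        ⋂ t, ⋂ (_ : t < N), (fun ω i => V t i ω) ⁻¹' Gᶜ := by
      ext ω
      simp
    rw [this]
    exact MeasurableSet.iInter fun t => MeasurableSet.iInter fun _ => hpre t hG.compl
  rw [hset, probReal_compl_eq_one_sub hmeas]
  refine sub_le_sub_left ?_ _
  have h1 : μ.real {ω | ∀ t < N, (fun i => V t i ω) ∈ Gᶜ} ≤ Real.exp (-Real.exp (-1)) ^ N := by
    refine ENNReal.toReal_le_of_le_ofReal (by positivity) ?_
    rwa [ENNReal.ofReal_pow (Real.exp_nonneg _)]
  refine h1.trans ?_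
  have hn' : (0 : ℝ) < n := by exact_mod_cast hn
  rw [← Real.exp_nat_mul, Real.rpow_def_of_pos hn', Real.exp_le_exp]
  have h2 := mul_le_mul_of_nonneg_right hN (Real.exp_nonneg (-1))
  have h3 : Real.exp 1 * Real.exp (-1) = 1 := by rw [← Real.exp_add]; simp
  have h4 : Real.exp 1 * q * Real.log n * Real.exp (-1) = q * Real.log n := by
    linear_combination q * Real.log n * h3
  linarith

/-- With high probability, a leader is elected within `O(q log n)` rounds. -/
theorem one_sub_rpow_neg_le_measureReal_elected {n : ℕ} (hn : 1 ≤ n)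
    {step : Finset Plane → Plane → Plane} {frame : Fin n → Plane ≃ᵃⁱ[ℝ] Plane}
    {pos₀ : Fin n → Plane} (hstep : IsInwardStep safeRadius step) (hmv : MutuallyVisible pos₀)
    {q : ℝ} (hq : 0 < q) {Ω : Type*} [MeasurableSpace Ω] {μ : Measure Ω} [IsProbabilityMeasure μ]
    {U : ℕ → Fin n → Ω → ℝ} (hU : ∀ t i, Measurable (U t i))
    (hunif : ∀ t i, pdf.IsUniform (U t i) (Set.Icc 0 1) μ)
    (hind : iIndepFun (fun a : ℕ × Fin n => U a.1 a.2) μ) :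
    1 - (n : ℝ) ^ (-q) ≤ μ.real {ω | ∃ t : ℕ, (t : ℝ) ≤ 2 * Real.exp 1 * q * Real.log n + 2 ∧
      Elected pos₀ ((leaderElection step).run frame pos₀ (fun t i => U t i ω) t)} := by
  classical
  -- For n = 1 the claimed lower bound is 1 - 1 = 0.
  rcases Nat.lt_or_ge n 2 with hlt | hn2
  · obtain rfl : n = 1 := by omega
    simp
  set S : Finset (Fin n) := Finset.univ.filter (Competes pos₀) with hSdef
  have hScard : numCompeting pos₀ = S.card := numOnCircle_positions hmv.injective _ _
  have hS : S.Nonempty := by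
    obtain ⟨p, hp, hpd⟩ := exists_dist_center_eq_radius (positions_nonempty (pos₀ := pos₀) hn)
    obtain ⟨i, rfl⟩ := mem_positions.1 hp
    exact ⟨i, Finset.mem_filter.2 ⟨Finset.mem_univ i, hpd⟩⟩
  set z : ℝ := Real.exp 1 * q * Real.log n with hz
  have hz0 : 0 ≤ z := by
    have := Real.log_natCast_nonneg n
    positivity
  -- Coins are flipped in even rounds only; restricting to these draws preserves independence.
  have hinj : Function.Injective fun a : ℕ × Fin n => (2 * a.1, a.2) := by
    rintro ⟨a, i⟩ ⟨b, j⟩ h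
    simp only [Prod.mk.injEq] at h
    exact Prod.ext (by omega) h.2
  -- With ⌊z⌋ + 1 iterations the successful index m is at most z, so the phase ends by round 2m + 2
  -- ≤ 2z + 2.
  refine (one_sub_rpow_neg_le_measureReal_exists_unique hn (V := fun m => U (2 * m))
    (fun m => hU _) (fun m => hunif _) (hind.precomp hinj) hS (q := q) (N := ⌊z⌋₊ + 1)
    (by push_cast; exact (Nat.lt_floor_add_one z).le)).trans (measureReal_mono ?_)
  rintro ω ⟨m, hm, huniq⟩
  refine ⟨2 * m + 2, ?_, elected_run_of_unique hn2 hstep hmv ?_⟩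
  · have h1 : (m : ℝ) ≤ z :=
      (Nat.cast_le.2 (Nat.lt_succ_iff.1 hm)).trans (Nat.floor_le hz0)
    push_cast
    linarith
  · simpa [Succeeds, hScard, S] using huniq

end FatRobots

theorem mainTheorem3 :
    ∃ (C : ℝ) (K : ℕ) (ρ : Finset FatRobots.Plane → ℝ), 0 < C ∧ (∀ P, 0 < ρ P) ∧
      ∀ step : Finset FatRobots.Plane → FatRobots.Plane → FatRobots.Plane,
        FatRobots.IsInwardStep ρ step →
      ∀ (n : ℕ), 1 ≤ n →
      ∀ (frame : Fin n → FatRobots.Plane ≃ᵃⁱ[ℝ] FatRobots.Plane)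
        (pos₀ : Fin n → FatRobots.Plane), FatRobots.MutuallyVisible pos₀ →
        -- what holds for every outcome of the coins, in every round
        (∀ (u : ℕ → Fin n → ℝ) (t : ℕ),
          let s := (FatRobots.leaderElection step).run frame pos₀ u
          -- collision-free, in convex position and mutually visible, also during the moves,
          -- whatever the speeds of the robots
          (∀ x : Fin n → FatRobots.Plane,
            (∀ i, x i ∈ segment ℝ ((s t).pos i) ((s (t + 1)).pos i)) →
              FatRobots.MutuallyVisible x) ∧
          -- as soon as one robot believes that the phase has ended, a leader is elected, for good
          (∀ i, ((s t).mem i).stage = .ended →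
            FatRobots.Elected pos₀ (s t) ∧ s (t + 1) = s t) ∧
          -- constant memory
          (∀ i, ((s t).mem i).Fits K (frame i) pos₀)) ∧
        -- the number of rounds
        (∀ (q : ℝ), 0 < q →
          ∀ (Ω : Type*) [MeasurableSpace Ω] (μ : MeasureTheory.Measure Ω)
            [MeasureTheory.IsProbabilityMeasure μ] (U : ℕ → Fin n → Ω → ℝ),
            (∀ t i, Measurable (U t i)) →
            (∀ t i, MeasureTheory.pdf.IsUniform (U t i) (Set.Icc 0 1) μ) →
            ProbabilityTheory.iIndepFun (fun a : ℕ × Fin n => U a.1 a.2) μ →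
            1 - (n : ℝ) ^ (-q) ≤
              μ.real {ω | ∃ t : ℕ, (t : ℝ) ≤ C * q * Real.log n + 2 ∧
                FatRobots.Elected pos₀
                  ((FatRobots.leaderElection step).run frame pos₀
                    (fun t i => U t i ω) t)}) := by
  -- C = 2e accounts for two rounds per iteration and e q log n iterations. K = 6 counts three
  -- integers, center and radius, and the stored location.
  refine ⟨2 * Real.exp 1, 6, FatRobots.safeRadius, by positivity,
    fun P => (FatRobots.safeRadius_spec P).1, fun step hstep n hn frame pos₀ hmv => ⟨?_, ?_⟩⟩
  · intro u t
    have hs := FatRobots.reachable_run (frame := frame) hn hstep hmv u t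
    exact ⟨fun x hx => hs.mutuallyVisible_of_mem_segment hn hstep hmv (u t) hx,
      fun i hi => hs.elected_of_ended hn hstep hmv hi (u t), hs.memory_fits⟩
  · intro q hq Ω _ μ _ U hU hunif hind
    exact FatRobots.one_sub_rpow_neg_le_measureReal_elected hn hstep hmv hq hU hunif hind
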